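/- Let $X$ be a complex abelian surface. For a class in $\mathbb{Z}\oplus \mathrm{NS}(X)\oplus\mathbb{Z}$ (a Mukai vector) write $x=(x_0,x_1,x_2)$, and put $\langle x,y\rangle=(x_1,y_1)-x_0y_2-x_2y_0$, $\langle x^2\rangle=\langle x,x\rangle$, extended linearly to real and complex coefficients. Let $\mathrm{Amp}(X)_{\mathbb{R}}$ (resp. $\overline{\mathrm{Amp}(X)}_{\mathbb{R}}$) be the cone of $x\in\mathrm{NS}(X)_{\mathbb{R}}$ with $(x^2)>0$ (resp. $(x^2)\ge 0$) and $(x,h)>0$, where $h$ is an ample class. Fix a norm on $\mathrm{NS}(X)_{\mathbb{R}}$ and identify the set of rays $C(V)=(V\setminus\{0\})/\mathbb{R}_{>0}$ of a cone $V$ with the elements of norm one in $V$. Set $$\mathfrak{H}=\mathrm{NS}(X)_{\mathbb{R}}\times C(\mathrm{Amp}(X)_{\mathbb{R}})\times\mathbb{R}_{>0},\qquad \overline{\mathfrak{H}}=\mathrm{NS}(X)_{\mathbb{R}}\times C(\overline{\mathrm{Amp}(X)}_{\mathbb{R}})\times\mathbb{R}_{\ge 0},$$ and, for $\beta,\omega\in\mathrm{NS}(X)_{\mathbb{R}}$,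 $Z_{(\beta,\omega)}(x)=\langle e^{\beta+\sqrt{-1}\,\omega},x\rangle$, where $e^{\gamma}=(1,\gamma,(\gamma^2)/2)$. Let $v$ and $v_1$ be Mukai vectors such that $\langle v_1,v-v_1\rangle>0$, $\langle v_1^2\rangle\ge 0$, $\langle (v-v_1)^2\rangle\ge 0$ and $v_1\notin\mathbb{Q}v$ (the last condition is automatic if $v$ is primitive), and let $$W_{v_1}=\{(\beta,H,t)\in\overline{\mathfrak{H}} \mid \mathbb{R}\,Z_{(\beta,tH)}(v_1)=\mathbb{R}\,Z_{(\beta,tH)}(v)\}.$$ Then $W_{v_1}\cap\mathfrak{H}\neq\emptyset$ if and only if $\langle v,v_1\rangle^2>\langle v^2\rangle\langle v_1^2\rangle$. -/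

import Mathlib

/-!
Complex abelian surfaces are taken as quotients `ℂ² / Λ` by a lattice `Λ` carrying a polarization.
Classes of degree two are translation invariant two-forms on `ℂ²`; the integral ones are those that
are integer valued on `Λ`.
-/

noncomputable section

namespace BridgelandWall

/-- The universal cover `ℂ²` of a two-dimensional complex torus. -/
abbrev Plane : Type := Fin 2 → ℂ

/-- `K`-valued real bilinear forms on `ℂ²` (`K = ℝ` or `ℂ`).  The alternating ones form
`H²(ℂ² / Λ, K)`. -/
abbrev Form (K : Type) [RCLike K] : Type := Plane →ₗ[ℝ] Plane →ₗ[ℝ] K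

/-- The scalar extension `H²(X, ℝ) → H²(X, K)`. -/
def Form.extend (K : Type) [RCLike K] (E : Form ℝ) : Form K :=
  E.compr₂ (Algebra.linearMap ℝ K)

/-- The value of the four-form `E ∧ F` on four vectors (sum over the `(2,2)`-shuffles). -/
def wedge {K : Type} [RCLike K] (E F : Form K) (u₁ u₂ u₃ u₄ : Plane) : K :=
  E u₁ u₂ * F u₃ u₄ - E u₁ u₃ * F u₂ u₄ + E u₁ u₄ * F u₂ u₃
    + E u₂ u₃ * F u₁ u₄ - E u₂ u₄ * F u₁ u₃ + E u₃ u₄ * F u₁ u₂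

/-- The intersection number `(E, F) = ∫_X E ∧ F` on the torus `X = ℂ² / Λ` with its complex
orientation: writing `E ∧ F = c dx₁ ∧ dy₁ ∧ dx₂ ∧ dy₂`, it is `c` times the volume of a
fundamental domain of `Λ`. -/
def intersection {K : Type} [RCLike K] (L : Submodule ℤ Plane) (E F : Form K) : K :=
  ((ZLattice.covolume L : ℝ) : K) *
    wedge E F ![1, 0] ![Complex.I, 0] ![0, 1] ![0, Complex.I]

/-- The Néron–Severi group of `ℂ² / Λ`: real alternating forms `E` on `ℂ²` that are integral on `Λ`
and of type `(1,1)`, that is, `E(ix, iy) = E(x, y)`. -/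
def neronSeveri (L : Submodule ℤ Plane) : Submodule ℤ (Form ℝ) where
  carrier := {E | (∀ x, E x x = 0) ∧ (∀ x ∈ L, ∀ y ∈ L, ∃ n : ℤ, E x y = n) ∧
    ∀ x y, E (Complex.I • x) (Complex.I • y) = E x y}
  zero_mem' := ⟨fun _ => rfl, fun _ _ _ _ => ⟨0, by simp⟩, fun _ _ => rfl⟩
  add_mem' := by
    rintro E F ⟨hE, hE', hE''⟩ ⟨hF, hF', hF''⟩
    refine ⟨fun x => by simp [hE x, hF x], fun x hx y hy => ?_, fun x y => ?_⟩
    · obtain ⟨m, hm⟩ := hE' x hx y hy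
      obtain ⟨n, hn⟩ := hF' x hx y hy
      exact ⟨m + n, by simp [hm, hn]⟩
    · simp only [LinearMap.add_apply, hE'' x y, hF'' x y]
  smul_mem' := by
    rintro c E ⟨hE, hE', hE''⟩
    refine ⟨fun x => by simp [hE x], fun x hx y hy => ?_, fun x y => ?_⟩
    · obtain ⟨m, hm⟩ := hE' x hx y hy
      exact ⟨c * m, by simp [hm]⟩
    · simp only [LinearMap.smul_apply, hE'' x y]

/-- A class in `NS` is ample if its Hermitian form `H(x, y) = E(ix, y) + i E(x, y)` is positive
definite. -/
def IsAmple (L : Submodule ℤ Plane) (E : Form ℝ) : Prop :=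
  E ∈ neronSeveri L ∧ ∀ x, x ≠ 0 → 0 < E (Complex.I • x) x

/-- A complex abelian surface `ℂ² / Λ`: a full lattice `Λ ⊆ ℂ²` such that the torus `ℂ² / Λ`
carries an ample class. -/
structure AbelianSurface where
  lattice : Submodule ℤ Plane
  discrete : DiscreteTopology lattice
  full : IsZLattice ℝ lattice
  exists_ample : ∃ h, IsAmple lattice h

namespace AbelianSurface

variable (X : AbelianSurface)

/-- The Néron–Severi group `NS(X)`. -/
abbrev NS : Submodule ℤ (Form ℝ) := neronSeveri X.lattice

/-- `NS(X)_ℝ`, as the real span of `NS(X)` in `H²(X, ℝ)`. -/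
abbrev NSR : Submodule ℝ (Form ℝ) := Submodule.span ℝ (X.NS : Set (Form ℝ))

/-- Mukai vectors, the elements `(r, ξ, a)` of `H^*(X, ℤ)_alg = ℤ ⊕ NS(X) ⊕ ℤ`. -/
abbrev MukaiVector : Type := ℤ × X.NS × ℤ

/-- The Mukai pairing `⟨(x₀, x₁, x₂), (y₀, y₁, y₂)⟩ = (x₁, y₁) - x₀ y₂ - x₂ y₀` with
coefficients in `K`. -/
def mukaiPairing {K : Type} [RCLike K] (x y : K × Form K × K) : K :=
  intersection X.lattice x.2.1 y.2.1 - x.1 * y.2.2 - x.2.2 * y.1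

variable {X} in
/-- The image of a Mukai vector in the Mukai lattice with coefficients in `K`. -/
def MukaiVector.extend (K : Type) [RCLike K] (v : X.MukaiVector) : K × Form K × K :=
  ((v.1 : K), Form.extend K (v.2.1 : Form ℝ), (v.2.2 : K))

/-- The Mukai pairing `⟨v, w⟩` of two Mukai vectors. -/
def pairing (v w : X.MukaiVector) : ℝ :=
  X.mukaiPairing (MukaiVector.extend ℝ v) (MukaiVector.extend ℝ w)

/-- `e^γ = (1, γ, (γ²)/2)` for a complex class `γ` of degree two. -/
def expClass (γ : Form ℂ) : ℂ × Form ℂ × ℂ :=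
  (1, γ, intersection X.lattice γ γ / 2)

/-- The stability function `Z_{(β, ω)}(v) = ⟨e^{β + iω}, v⟩`. -/
def centralCharge (β ω : X.NSR) (v : X.MukaiVector) : ℂ :=
  X.mukaiPairing
    (X.expClass (Form.extend ℂ (β : Form ℝ) + Complex.I • Form.extend ℂ (ω : Form ℝ)))
    (MukaiVector.extend ℂ v)

/-- `Amp(X)_ℝ`. -/
def amp : Set X.NSR :=
  {x | 0 < intersection X.lattice (x : Form ℝ) x ∧
    ∃ h, IsAmple X.lattice h ∧ 0 < intersection X.lattice (x : Form ℝ) h}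

/-- The cone written `Amp(X)_ℝ` with a bar, where `(x²) = 0` is allowed. -/
def ampBar : Set X.NSR :=
  {x | 0 ≤ intersection X.lattice (x : Form ℝ) x ∧
    ∃ h, IsAmple X.lattice h ∧ 0 < intersection X.lattice (x : Form ℝ) h}

/-- A norm on `NS(X)_ℝ`.  It identifies the cone of rays `C(V) = (V ∖ {0}) / ℝ_{>0}` with the
elements of norm one of `V`. -/
structure Norm extends Seminorm ℝ X.NSR where
  eq_zero_of_map_eq_zero : ∀ x : X.NSR, toSeminorm x = 0 → x = 0

variable (p : X.Norm)

/-- The open parameter space `NS(X)_ℝ × C(Amp(X)_ℝ) × ℝ_{>0}` of triples `(β, H, t)`. -/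
def parameterSpace : Set (X.NSR × X.NSR × ℝ) :=
  {q | q.2.1 ∈ X.amp ∧ p.toSeminorm q.2.1 = 1 ∧ 0 < q.2.2}

/-- The extended parameter space, in which `(H²) = 0` and `t = 0` are allowed. -/
def parameterSpaceBar : Set (X.NSR × X.NSR × ℝ) :=
  {q | q.2.1 ∈ X.ampBar ∧ p.toSeminorm q.2.1 = 1 ∧ 0 ≤ q.2.2}

/-- The wall `W_{v₁}` for `v`: the points `(β, H, t)` of the extended parameter space with
`ℝ Z_{(β, tH)}(v₁) = ℝ Z_{(β, tH)}(v)`. -/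
def wall (v v₁ : X.MukaiVector) : Set (X.NSR × X.NSR × ℝ) :=
  {q | q ∈ X.parameterSpaceBar p ∧
    Submodule.span ℝ {X.centralCharge q.1 (q.2.2 • q.2.1) v₁} =
      Submodule.span ℝ {X.centralCharge q.1 (q.2.2 • q.2.1) v}}

end AbelianSurface

end BridgelandWall

end

/-!
Write `Z` for the central charge at `(β, ω)` with `(ω²) > 0`, extended to real Mukai vectors.  Real
forms of type `(1,1)` are Hermitian `2 × 2` matrices and the intersection form is a positive multiple
of the polarized determinant, so it has signature `(1, ·)` on `NS(X)_ℝ`: the orthogonal complement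
of a class of positive square is negative definite (`intersection_self_neg_of_orthogonal`).
It follows that a nonzero real Mukai vector in the kernel of some `Z` has negative square
(`mukaiForm_self_neg_of_charge_eq_zero`), and conversely that a real Mukai vector of negative square
is in the kernel of `Z` for some `β` and some `ω` in the ample cone
(`exists_charge_eq_zero_of_mukaiForm_self_neg`).

At a point of the wall, `Z(v₁ - c v) = 0` for a real number `c`, and `v₁ - c v ≠ 0` because a real
ratio of integral vectors is rational; so the Mukai pairing takes a negative value on the plane
spanned by `v` and `v₁`.  As `⟨v₁²⟩ ≥ 0` and `⟨v, v₁⟩ > 0`, it has negative discriminant there.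
Conversely, if the discriminant is negative, the plane contains a vector `x v₁ - y (v - v₁)` of
negative square with `x, y > 0`.  Where `Z` vanishes on it, `Z(v)` is a positive multiple of
`Z(v₁)`, so the point lies on the wall.
-/

noncomputable section

namespace BridgelandWall

open Complex

/-! ### The intersection form -/

/-- The intersection number of real classes as a bilinear form. -/
def intersectionForm (L : Submodule ℤ Plane) : LinearMap.BilinForm ℝ (Form ℝ) :=
  LinearMap.mk₂ ℝ (fun E F => intersection L E F)
    (fun _ _ _ => by simp only [intersection, wedge, LinearMap.add_apply]; ring)
    (fun _ _ _ => by simp only [intersection, wedge, LinearMap.smul_apply, smul_eq_mul]; ring)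
    (fun _ _ _ => by simp only [intersection, wedge, LinearMap.add_apply]; ring)
    (fun _ _ _ => by simp only [intersection, wedge, LinearMap.smul_apply, smul_eq_mul]; ring)

theorem intersection_eq (L : Submodule ℤ Plane) (E F : Form ℝ) :
    intersection L E F = intersectionForm L E F := rfl

theorem intersectionForm_comm (L : Submodule ℤ Plane) (E F : Form ℝ) :
    intersectionForm L E F = intersectionForm L F E := by
  simp only [← intersection_eq, intersection, wedge]; ring

theorem intersection_extend (L : Submodule ℤ Plane) (E F : Form ℝ) :
    intersection L (Form.extend ℂ E) (Form.extend ℂ F) = (intersectionForm L E F : ℂ) := by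
  simp [← intersection_eq, intersection, wedge, Form.extend]

/-- The intersection number of a complex class, given by its real and imaginary parts, with a real
class. -/
theorem intersection_complex_left (L : Submodule ℤ Plane) (β ω E : Form ℝ) :
    intersection L (Form.extend ℂ β + I • Form.extend ℂ ω) (Form.extend ℂ E) =
      intersectionForm L β E + I * intersectionForm L ω E := by
  simp only [← intersection_extend, intersection, wedge, LinearMap.add_apply,
    LinearMap.smul_apply, smul_eq_mul]
  ring

theorem intersection_complex_self (L : Submodule ℤ Plane) (β ω : Form ℝ) :
    intersection L (Form.extend ℂ β + I • Form.extend ℂ ω)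
        (Form.extend ℂ β + I • Form.extend ℂ ω) =
      intersectionForm L β β - intersectionForm L ω ω + 2 * I * intersectionForm L β ω := by
  simp only [← intersection_extend, intersection, wedge, LinearMap.add_apply,
    LinearMap.smul_apply, smul_eq_mul]
  ring_nf
  simp only [I_sq]
  ring

/-! ### Forms of type (1,1) and the Hodge index theorem -/

/-- Real alternating forms `E` of type `(1,1)`, that is, `E(ix, iy) = E(x, y)`. -/
def hermitianForms : Submodule ℝ (Form ℝ) where
  carrier := {E | (∀ x, E x x = 0) ∧ ∀ x y, E (I • x) (I • y) = E x y}
  zero_mem' := ⟨fun _ => rfl, fun _ _ => rfl⟩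
  add_mem' := by
    rintro E F ⟨hE, hE'⟩ ⟨hF, hF'⟩
    exact ⟨fun x => by simp [hE x, hF x],
      fun x y => by simp only [LinearMap.add_apply, hE' x y, hF' x y]⟩
  smul_mem' := by
    rintro c E ⟨hE, hE'⟩
    exact ⟨fun x => by simp [hE x], fun x y => by simp only [LinearMap.smul_apply, hE' x y]⟩

theorem AbelianSurface.NSR_le_hermitianForms (X : AbelianSurface) : X.NSR ≤ hermitianForms :=
  Submodule.span_le.2 fun _ hE => ⟨hE.1, hE.2.2⟩

theorem hermitianForms_neg {E : Form ℝ} (hE : E ∈ hermitianForms) (x y : Plane) :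
    E x y = -E y x := by
  have h := hE.1 (x + y)
  simp only [map_add, LinearMap.add_apply, hE.1 x, hE.1 y] at h
  linarith

/-- The matrix of a form of type `(1,1)` in the basis `e₁, i e₁, e₂, i e₂` depends on four of its
entries only. -/
theorem hermitianForms_entries {E : Form ℝ} (hE : E ∈ hermitianForms) :
    E ![I, 0] ![0, I] = E ![1, 0] ![0, 1] ∧ E ![I, 0] ![0, 1] = -E ![1, 0] ![0, I] := by
  have h₁ := hE.2 ![1, 0] ![0, 1]
  have h₂ := hE.2 ![I, 0] ![0, 1]
  have e₁ : I • (![1, 0] : Plane) = ![I, 0] := by ext i; fin_cases i <;> simp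
  have e₂ : I • (![0, 1] : Plane) = ![0, I] := by ext i; fin_cases i <;> simp
  have e₃ : I • (![I, 0] : Plane) = -![1, 0] := by ext i; fin_cases i <;> simp
  rw [e₁, e₂] at h₁
  rw [e₃, e₂, map_neg, LinearMap.neg_apply] at h₂
  exact ⟨h₁, h₂.symm⟩

/-- Up to the covolume, the intersection form is the polarization of twice the determinant of
Hermitian matrices. -/
theorem intersectionForm_hermitian (L : Submodule ℤ Plane) {E F : Form ℝ}
    (hE : E ∈ hermitianForms) (hF : F ∈ hermitianForms) :
    intersectionForm L E F = ZLattice.covolume L *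
      (E ![1, 0] ![I, 0] * F ![0, 1] ![0, I] + E ![0, 1] ![0, I] * F ![1, 0] ![I, 0]
        - 2 * (E ![1, 0] ![0, 1] * F ![1, 0] ![0, 1])
        - 2 * (E ![1, 0] ![0, I] * F ![1, 0] ![0, I])) := by
  obtain ⟨h₁, h₂⟩ := hermitianForms_entries hE
  obtain ⟨h₃, h₄⟩ := hermitianForms_entries hF
  simp only [← intersection_eq, intersection, wedge, h₁, h₂, h₃, h₄, RCLike.ofReal_real_eq_id, id]
  ring

theorem plane_eq (x : Plane) :
    x = (x 0).re • ![1, 0] + (x 0).im • ![I, 0] + (x 1).re • ![0, 1] + (x 1).im • ![0, I] := by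
  ext i
  fin_cases i <;> simp [Complex.re_add_im]

theorem hermitianForms_eq_zero {E : Form ℝ} (hE : E ∈ hermitianForms)
    (h₁ : E ![1, 0] ![I, 0] = 0) (h₂ : E ![0, 1] ![0, I] = 0)
    (h₃ : E ![1, 0] ![0, 1] = 0) (h₄ : E ![1, 0] ![0, I] = 0) : E = 0 := by
  obtain ⟨h₅, h₆⟩ := hermitianForms_entries hE
  rw [h₃] at h₅
  rw [h₄, neg_zero] at h₆
  have s₁ := hermitianForms_neg hE ![I, 0] ![1, 0]
  have s₂ := hermitianForms_neg hE ![0, I] ![0, 1]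
  have s₃ := hermitianForms_neg hE ![0, 1] ![1, 0]
  have s₄ := hermitianForms_neg hE ![0, I] ![1, 0]
  have s₅ := hermitianForms_neg hE ![0, I] ![I, 0]
  have s₆ := hermitianForms_neg hE ![0, 1] ![I, 0]
  refine LinearMap.ext₂ fun x y => ?_
  rw [plane_eq x, plane_eq y]
  simp only [map_add, map_smul, LinearMap.add_apply, LinearMap.smul_apply, hE.1, s₁, s₂, s₃, s₄,
    s₅, s₆, h₁, h₂, h₃, h₄, h₅, h₆, smul_zero, neg_zero, add_zero, LinearMap.zero_apply]

/-- The polarized determinant of Hermitian matrices: a matrix orthogonal to one of positive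
determinant has negative determinant, or is zero. -/
theorem hermitian_eq_zero_of_orthogonal {a d b c a' d' b' c' : ℝ} (hdet : b ^ 2 + c ^ 2 < a * d)
    (horth : a * d' + d * a' = 2 * (b * b' + c * c'))
    (hdet' : b' ^ 2 + c' ^ 2 ≤ a' * d') : a' = 0 ∧ d' = 0 ∧ b' = 0 ∧ c' = 0 := by
  have had : 0 < a * d := by nlinarith [sq_nonneg b, sq_nonneg c]
  have hcs : (b * b' + c * c') ^ 2 ≤ (b ^ 2 + c ^ 2) * (b' ^ 2 + c' ^ 2) := by
    nlinarith [sq_nonneg (b * c' - c * b')]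
  have hamgm : (a * d) * (a' * d') ≤ (b * b' + c * c') ^ 2 := by
    have : (b * b' + c * c') ^ 2 = (a * d' + d * a') ^ 2 / 4 := by rw [horth]; ring
    nlinarith [sq_nonneg (a * d' - d * a')]
  have hmul := mul_le_mul_of_nonneg_left hdet' had.le
  have hzero : b' ^ 2 + c' ^ 2 = 0 := by
    by_contra hne
    have hpos : 0 < b' ^ 2 + c' ^ 2 := lt_of_le_of_ne (by positivity) (Ne.symm hne)
    nlinarith [mul_lt_mul_of_pos_right hdet hpos]
  have hb : b' = 0 := by nlinarith [sq_nonneg b', sq_nonneg c']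
  have hc : c' = 0 := by nlinarith [sq_nonneg b', sq_nonneg c']
  subst hb hc
  have horth' : a * d' = -(d * a') := by linarith
  have ha : (d * a') ^ 2 ≤ 0 := by
    have : (d * a') ^ 2 = -((a * d) * (a' * d')) := by linear_combination (d * a') * horth'
    have := mul_nonneg had.le (by simpa using hdet' : 0 ≤ a' * d')
    linarith
  have ha0 : d * a' = 0 := by nlinarith [sq_nonneg (d * a')]
  have hd : d ≠ 0 := right_ne_zero_of_mul had.ne'
  have ha : a ≠ 0 := left_ne_zero_of_mul had.ne'
  have hd0 : a * d' = 0 := by rw [horth', ha0, neg_zero]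
  exact ⟨(mul_eq_zero.1 ha0).resolve_left hd, (mul_eq_zero.1 hd0).resolve_left ha, rfl, rfl⟩

namespace AbelianSurface

variable (X : AbelianSurface)

theorem covolume_pos : 0 < ZLattice.covolume X.lattice :=
  have := X.discrete
  have := X.full
  ZLattice.covolume_pos X.lattice

/-- The Hodge index theorem. -/
theorem intersection_self_neg_of_orthogonal {ω η : Form ℝ} (hω : ω ∈ hermitianForms)
    (hη : η ∈ hermitianForms) (hpos : 0 < intersectionForm X.lattice ω ω)
    (horth : intersectionForm X.lattice ω η = 0) (hne : η ≠ 0) :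
    intersectionForm X.lattice η η < 0 := by
  have hV := X.covolume_pos
  rw [intersectionForm_hermitian _ hω hω] at hpos
  rw [intersectionForm_hermitian _ hω hη] at horth
  rw [intersectionForm_hermitian _ hη hη]
  have hpos := (mul_pos_iff_of_pos_left hV).1 hpos
  have horth := (mul_eq_zero.1 horth).resolve_left hV.ne'
  by_contra hneg
  have hneg := (mul_nonneg_iff_of_pos_left hV).1 (not_lt.1 hneg)
  obtain ⟨h₁, h₂, h₃, h₄⟩ := hermitian_eq_zero_of_orthogonal (a := ω ![1, 0] ![I, 0])
    (d := ω ![0, 1] ![0, I]) (b := ω ![1, 0] ![0, 1]) (c := ω ![1, 0] ![0, I])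
    (a' := η ![1, 0] ![I, 0]) (d' := η ![0, 1] ![0, I]) (b' := η ![1, 0] ![0, 1])
    (c' := η ![1, 0] ![0, I]) (by linarith) (by linarith) (by linarith)
  exact hne (hermitianForms_eq_zero hη h₁ h₂ h₃ h₄)

theorem intersection_self_nonpos_of_orthogonal {ω η : Form ℝ} (hω : ω ∈ hermitianForms)
    (hη : η ∈ hermitianForms) (hpos : 0 < intersectionForm X.lattice ω ω)
    (horth : intersectionForm X.lattice ω η = 0) :
    intersectionForm X.lattice η η ≤ 0 := by
  rcases eq_or_ne η 0 with rfl | hne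
  · simp
  · exact (X.intersection_self_neg_of_orthogonal hω hη hpos horth hne).le

theorem intersection_self_pos_of_isAmple {h : Form ℝ} (hh : IsAmple X.lattice h) :
    0 < intersectionForm X.lattice h h := by
  have hH : h ∈ hermitianForms := ⟨hh.1.1, hh.1.2.2⟩
  rw [intersectionForm_hermitian _ hH hH]
  refine mul_pos X.covolume_pos ?_
  obtain ⟨h₁, h₂⟩ := hermitianForms_entries hH
  have s₁ := hermitianForms_neg hH ![I, 0] ![1, 0]
  have s₂ := hermitianForms_neg hH ![0, I] ![0, 1]
  have s₃ := hermitianForms_neg hH ![0, 1] ![1, 0]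
  have s₄ := hermitianForms_neg hH ![0, I] ![1, 0]
  have hd : h ![0, 1] ![0, I] < 0 := by
    have := hh.2 ![0, 1] (fun h0 => by simpa using congrFun h0 1)
    have e : I • (![0, 1] : Plane) = ![0, I] := by ext i; fin_cases i <;> simp
    rw [e, s₂] at this
    linarith
  set a := h ![1, 0] ![I, 0]
  set d := h ![0, 1] ![0, I]
  set b := h ![1, 0] ![0, 1]
  set c := h ![1, 0] ![0, I]
  -- The vector `x` is the first row of the adjugate of the Hermitian matrix of `h`, so that the
  -- value at `x` is the determinant times the diagonal entry `-d`.
  let x : Plane := (-d) • ![1, 0] + c • ![0, 1] + (-b) • ![0, I]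
  have hx : x ≠ 0 := fun h0 => hd.ne (by simpa [x] using congrFun h0 0)
  have hIx : I • x = (-d) • ![I, 0] + c • ![0, I] + b • ![0, 1] := by
    ext i
    fin_cases i
    · simp [x, mul_comm]
    · simp only [x, Pi.smul_apply, Pi.add_apply, Fin.mk_one, Matrix.cons_val_one,
        Matrix.cons_val_fin_one, smul_eq_mul, Complex.real_smul]
      push_cast
      linear_combination (-(b : ℂ)) * I_sq
  have hpos := hh.2 x hx
  rw [hIx] at hpos
  simp only [x, map_add, map_smul, LinearMap.add_apply, LinearMap.smul_apply, smul_eq_mul,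
    hH.1, s₁, s₂, s₃, s₄, h₁, h₂] at hpos
  have hpos' : 0 < (-d) * (a * d - b ^ 2 - c ^ 2) := by
    refine hpos.trans_eq ?_
    ring
  have := (mul_pos_iff_of_pos_left (neg_pos.2 hd)).1 hpos'
  linarith

/-! ### Real Mukai vectors -/

/-- The Mukai pairing of real Mukai vectors as a bilinear form. -/
def mukaiForm : LinearMap.BilinForm ℝ (ℝ × Form ℝ × ℝ) :=
  LinearMap.mk₂ ℝ (fun x y => X.mukaiPairing x y)
    (fun _ _ _ => by
      simp only [mukaiPairing, intersection_eq, Prod.fst_add, Prod.snd_add, map_add,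
        LinearMap.add_apply]; ring)
    (fun _ _ _ => by
      simp only [mukaiPairing, intersection_eq, Prod.smul_fst, Prod.smul_snd, map_smul,
        LinearMap.smul_apply, smul_eq_mul]; ring)
    (fun _ _ _ => by
      simp only [mukaiPairing, intersection_eq, Prod.fst_add, Prod.snd_add, map_add]; ring)
    (fun _ _ _ => by
      simp only [mukaiPairing, intersection_eq, Prod.smul_fst, Prod.smul_snd, map_smul,
        smul_eq_mul]; ring)

theorem mukaiForm_apply (x y : ℝ × Form ℝ × ℝ) :
    X.mukaiForm x y =
      intersectionForm X.lattice x.2.1 y.2.1 - x.1 * y.2.2 - x.2.2 * y.1 := rfl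

theorem mukaiForm_comm (x y : ℝ × Form ℝ × ℝ) : X.mukaiForm x y = X.mukaiForm y x := by
  rw [mukaiForm_apply, mukaiForm_apply, intersectionForm_comm]; ring

theorem pairing_eq (v w : X.MukaiVector) :
    X.pairing v w = X.mukaiForm (MukaiVector.extend ℝ v) (MukaiVector.extend ℝ w) := rfl

variable {X} in
theorem MukaiVector.extend_real (v : X.MukaiVector) :
    MukaiVector.extend ℝ v = ((v.1 : ℝ), (v.2.1 : Form ℝ), (v.2.2 : ℝ)) := rfl

variable {X} in
theorem MukaiVector.extend_sub (v w : X.MukaiVector) :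
    MukaiVector.extend ℝ (v - w) = MukaiVector.extend ℝ v - MukaiVector.extend ℝ w := by
  simp [MukaiVector.extend_real]

/-- The central charge `x ↦ ⟨e^{β + iω}, x⟩` on real Mukai vectors, given by its real and imaginary
parts. -/
def charge (β ω : Form ℝ) : (ℝ × Form ℝ × ℝ) →ₗ[ℝ] ℂ where
  toFun x :=
    ⟨intersectionForm X.lattice β x.2.1 - x.2.2
        - x.1 * (intersectionForm X.lattice β β - intersectionForm X.lattice ω ω) / 2,
      intersectionForm X.lattice ω x.2.1 - x.1 * intersectionForm X.lattice β ω⟩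
  map_add' x y := by
    apply Complex.ext <;>
    simp only [Prod.fst_add, Prod.snd_add, map_add, Complex.add_re, Complex.add_im] <;> ring
  map_smul' c x := by
    apply Complex.ext <;>
    simp only [Prod.smul_fst, Prod.smul_snd, map_smul, smul_eq_mul, Complex.smul_re,
      Complex.smul_im, RingHom.id_apply] <;> ring

theorem charge_eq_zero_iff (β ω : Form ℝ) (x : ℝ × Form ℝ × ℝ) :
    X.charge β ω x = 0 ↔
      intersectionForm X.lattice β x.2.1 - x.2.2
        - x.1 * (intersectionForm X.lattice β β - intersectionForm X.lattice ω ω) / 2 = 0 ∧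
      intersectionForm X.lattice ω x.2.1 - x.1 * intersectionForm X.lattice β ω = 0 :=
  Complex.ext_iff

theorem centralCharge_eq_charge (β ω : X.NSR) (v : X.MukaiVector) :
    X.centralCharge β ω v = X.charge β ω (MukaiVector.extend ℝ v) := by
  have h : X.centralCharge β ω v =
      (intersectionForm X.lattice β v.2.1 + I * intersectionForm X.lattice ω v.2.1) - 1 * v.2.2
        - (intersectionForm X.lattice β β - intersectionForm X.lattice ω ω
          + 2 * I * intersectionForm X.lattice β ω) / 2 * v.1 := by
    simp only [← intersection_complex_left, ← intersection_complex_self]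
    rfl
  rw [h]
  have h' : X.charge β ω (MukaiVector.extend ℝ v) =
      ((intersectionForm X.lattice β v.2.1 - v.2.2
        - v.1 * (intersectionForm X.lattice β β - intersectionForm X.lattice ω ω) / 2 : ℝ) : ℂ) +
      ((intersectionForm X.lattice ω v.2.1 - v.1 * intersectionForm X.lattice β ω : ℝ) : ℂ) * I :=
    Complex.mk_eq_add_mul_I _ _
  rw [h']
  push_cast
  ring

/-! ### Kernels of central charges -/

/-- The kernel of a central charge with `(ω²) > 0` is the orthogonal complement of the positive
definite plane spanned by the real and imaginary parts of `e^{β + iω}`, hence negative definite. -/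
theorem mukaiForm_self_neg_of_charge_eq_zero {β ω : Form ℝ} (hβ : β ∈ hermitianForms)
    (hω : ω ∈ hermitianForms) (hpos : 0 < intersectionForm X.lattice ω ω)
    {u : ℝ × Form ℝ × ℝ} (hu : u.2.1 ∈ hermitianForms) (hZ : X.charge β ω u = 0) (hne : u ≠ 0) :
    X.mukaiForm u u < 0 := by
  obtain ⟨r, ξ, a⟩ := u
  obtain ⟨hre, him⟩ := (X.charge_eq_zero_iff _ _ _).1 hZ
  rw [mukaiForm_apply]
  dsimp only at hu hre him ⊢
  rcases eq_or_ne r 0 with rfl | hr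
  · rcases eq_or_ne ξ 0 with rfl | hξ
    · refine absurd ?_ hne
      have : a = 0 := by simpa using hre
      simp [this]
    · have := X.intersection_self_neg_of_orthogonal hω hu hpos (by linarith) hξ
      linarith
  · -- The class `r β - ξ` is orthogonal to `ω`.
    have hη := X.intersection_self_nonpos_of_orthogonal hω
      (sub_mem (Submodule.smul_mem _ r hβ) hu) hpos
      (by
        simp only [map_sub, map_smul, smul_eq_mul, intersectionForm_comm X.lattice ω β]
        linarith)
    simp only [map_sub, map_smul, smul_eq_mul, LinearMap.sub_apply, LinearMap.smul_apply,
      intersectionForm_comm X.lattice ξ β] at hη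
    have := mul_pos (pow_pos (abs_pos.2 hr) 2) hpos
    rw [sq_abs] at this
    linear_combination hη + this + 2 * r * hre

/-- A real Mukai vector of negative square lies in the kernel of the central charge of some `β` and
some `ω` in the ample cone. -/
theorem exists_charge_eq_zero_of_mukaiForm_self_neg {u : ℝ × Form ℝ × ℝ} (hu : u.2.1 ∈ X.NSR)
    (hneg : X.mukaiForm u u < 0) :
    ∃ β ω : X.NSR, ω ∈ X.amp ∧ X.charge β ω u = 0 := by
  obtain ⟨h, hh⟩ := X.exists_ample
  have hh2 := X.intersection_self_pos_of_isAmple hh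
  have hNS : h ∈ X.NSR := Submodule.subset_span hh.1
  obtain ⟨r, ξ, a⟩ := u
  rw [mukaiForm_apply] at hneg
  dsimp only at hu hneg
  simp only [charge_eq_zero_iff]
  rcases eq_or_ne r 0 with rfl | hr
  · -- For rank zero, `ω` is the orthogonal projection of `h` to the complement of `ξ`.
    have hξ : intersectionForm X.lattice ξ ξ < 0 := by linarith
    have hξ' := hξ.ne
    have key : 0 < intersectionForm X.lattice h h - intersectionForm X.lattice h ξ /
        intersectionForm X.lattice ξ ξ * intersectionForm X.lattice h ξ := by
      have : intersectionForm X.lattice h ξ / intersectionForm X.lattice ξ ξ *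
          intersectionForm X.lattice h ξ ≤ 0 := by
        rw [div_mul_eq_mul_div]
        exact div_nonpos_of_nonneg_of_nonpos (mul_self_nonneg _) hξ.le
      linarith
    refine ⟨⟨(a / intersectionForm X.lattice ξ ξ) • ξ, Submodule.smul_mem _ _ hu⟩,
      ⟨h - (intersectionForm X.lattice h ξ / intersectionForm X.lattice ξ ξ) • ξ,
        sub_mem hNS (Submodule.smul_mem _ _ hu)⟩, ⟨?_, h, hh, ?_⟩, ?_, ?_⟩
    · simp only [intersection_eq, map_sub, map_smul, LinearMap.sub_apply, LinearMap.smul_apply,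
        smul_eq_mul, intersectionForm_comm X.lattice ξ h]
      convert key using 1
      field_simp
      ring
    · simpa only [intersection_eq, map_sub, map_smul, LinearMap.sub_apply, LinearMap.smul_apply,
        smul_eq_mul, intersectionForm_comm X.lattice ξ h] using key
    · simp only [map_smul, LinearMap.smul_apply, smul_eq_mul]
      field_simp
      ring
    · simp only [map_sub, map_smul, LinearMap.sub_apply, LinearMap.smul_apply, smul_eq_mul]
      field_simp
      ring
  · -- For nonzero rank, `β = ξ / r` and `ω` is the multiple of `h` with `(ω²) = -⟨u²⟩ / r²`.
    set q := intersectionForm X.lattice ξ ξ with hq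
    have hs : 0 < -(q - r * a - a * r) / r ^ 2 / intersectionForm X.lattice h h := by
      have : 0 < r ^ 2 := by positivity
      exact div_pos (div_pos (by linarith) this) hh2
    set s := √(-(q - r * a - a * r) / r ^ 2 / intersectionForm X.lattice h h) with hs_def
    have hs0 : 0 < s := Real.sqrt_pos.2 hs
    have hs2 : s * s = -(q - r * a - a * r) / r ^ 2 / intersectionForm X.lattice h h :=
      Real.mul_self_sqrt hs.le
    refine ⟨⟨r⁻¹ • ξ, Submodule.smul_mem _ _ hu⟩, ⟨s • h, Submodule.smul_mem _ _ hNS⟩,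
      ⟨?_, h, hh, ?_⟩, ?_, ?_⟩
    · simp only [intersection_eq, map_smul, LinearMap.smul_apply, smul_eq_mul]
      positivity
    · simp only [intersection_eq, map_smul, LinearMap.smul_apply, smul_eq_mul]
      positivity
    · simp only [map_smul, LinearMap.smul_apply, smul_eq_mul, ← hq]
      rw [← mul_assoc s s, hs2]
      field_simp
      ring
    · simp only [map_smul, LinearMap.smul_apply, smul_eq_mul, intersectionForm_comm X.lattice ξ h]
      field_simp
      ring

/-- The central charges do not see the identification of rays with vectors of norm one: each
`ω` in the ample cone is `t H` for a point `(β, H, t)` of the parameter space. -/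
theorem exists_mem_parameterSpace (p : X.Norm) (β : X.NSR) {ω : X.NSR} (hω : ω ∈ X.amp) :
    ∃ H t, t • H = ω ∧ (β, H, t) ∈ X.parameterSpace p := by
  have hne : p.toSeminorm ω ≠ 0 := fun h0 => by
    have h1 := hω.1
    rw [p.eq_zero_of_map_eq_zero ω h0] at h1
    simp [intersection_eq] at h1
  have hpos : 0 < p.toSeminorm ω := lt_of_le_of_ne (apply_nonneg _ _) (Ne.symm hne)
  obtain ⟨h1, h, hh, h2⟩ := hω
  rw [intersection_eq] at h1 h2
  refine ⟨(p.toSeminorm ω)⁻¹ • ω, p.toSeminorm ω, smul_inv_smul₀ hne ω, ⟨?_, h, hh, ?_⟩, ?_, hpos⟩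
  · simp only [intersection_eq, Submodule.coe_smul, map_smul, LinearMap.smul_apply, smul_eq_mul]
    positivity
  · simp only [intersection_eq, Submodule.coe_smul, map_smul, LinearMap.smul_apply, smul_eq_mul]
    positivity
  · rw [map_smul_eq_mul, norm_inv, Real.norm_of_nonneg hpos.le, inv_mul_cancel₀ hne]

theorem parameterSpace_subset_bar (p : X.Norm) : X.parameterSpace p ⊆ X.parameterSpaceBar p :=
  fun _ hq => ⟨⟨hq.1.1.le, hq.1.2⟩, hq.2.1, hq.2.2.le⟩

/-! ### Proportional integral vectors -/

/-- A form vanishing on pairs of vectors of a full lattice is zero. -/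
theorem exists_lattice_apply_ne_zero {E : Form ℝ} (hE : E ≠ 0) :
    ∃ x ∈ X.lattice, ∃ y ∈ X.lattice, E x y ≠ 0 := by
  by_contra! h
  have hspan : Submodule.span ℝ (X.lattice : Set Plane) = ⊤ :=
    have := X.full
    IsZLattice.span_top
  refine hE (LinearMap.ext_on hspan fun x hx => LinearMap.ext_on hspan fun y hy => ?_)
  exact h x hx y hy

variable {X} in
/-- A real ratio of integral Mukai vectors is rational. -/
theorem exists_int_smul_eq_of_extend_eq_smul {v w : X.MukaiVector} (hv : v ≠ 0) {c : ℝ}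
    (h : MukaiVector.extend ℝ w = c • MukaiVector.extend ℝ v) :
    ∃ m n : ℤ, n ≠ 0 ∧ n • w = m • v := by
  obtain ⟨r, ξ, a⟩ := v
  obtain ⟨r', ξ', a'⟩ := w
  simp only [MukaiVector.extend_real, Prod.smul_mk, smul_eq_mul, Prod.mk.injEq] at h
  obtain ⟨h₁, h₂, h₃⟩ := h
  have key : ∃ m n : ℤ, n ≠ 0 ∧ (m : ℝ) = c * n := by
    by_cases hr : r = 0
    · by_cases ha : a = 0
      · have hξ : (ξ : Form ℝ) ≠ 0 := fun h0 => hv (by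
          rw [hr, ha, (Subtype.ext h0 : ξ = 0)]; rfl)
        obtain ⟨x, hx, y, hy, hxy⟩ := X.exists_lattice_apply_ne_zero hξ
        obtain ⟨n, hn⟩ := ξ.2.2.1 x hx y hy
        obtain ⟨m, hm⟩ := ξ'.2.2.1 x hx y hy
        refine ⟨m, n, fun h0 => hxy (by rw [hn, h0, Int.cast_zero]), ?_⟩
        rw [← hn, ← hm, h₂]
        rfl
      · exact ⟨a', a, ha, h₃⟩
    · exact ⟨r', r, hr, h₁⟩
  obtain ⟨m, n, hn, hmn⟩ := key
  refine ⟨m, n, hn, Prod.ext ?_ (Prod.ext (Subtype.ext ?_) ?_)⟩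
  · have : (n : ℝ) * r' = m * r := by rw [h₁, hmn]; ring
    simpa using mod_cast this
  · have : (n : ℝ) • (ξ' : Form ℝ) = (m : ℝ) • (ξ : Form ℝ) := by
      rw [h₂, hmn, smul_smul, mul_comm]
    change n • (ξ' : Form ℝ) = m • (ξ : Form ℝ)
    rw [← Int.cast_smul_eq_zsmul ℝ, ← Int.cast_smul_eq_zsmul ℝ m]
    exact this
  · have : (n : ℝ) * a' = m * a := by rw [h₃, hmn]; ring
    simpa using mod_cast this

end AbelianSurface

end BridgelandWall

end

open BridgelandWall BridgelandWall.AbelianSurface in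
theorem mainTheorem7 (X : BridgelandWall.AbelianSurface) (p : X.Norm)
    (v v₁ : X.MukaiVector)
    (h_pos : 0 < X.pairing v₁ (v - v₁))
    (h_sq : 0 ≤ X.pairing v₁ v₁)
    (h_sq' : 0 ≤ X.pairing (v - v₁) (v - v₁))
    (h_indep : ∀ m n : ℤ, n ≠ 0 → n • v₁ ≠ m • v) :
    (X.wall p v v₁ ∩ X.parameterSpace p).Nonempty ↔
      X.pairing v v * X.pairing v₁ v₁ < X.pairing v v₁ ^ 2 := by
  have hNS (w : X.MukaiVector) : (MukaiVector.extend ℝ w).2.1 ∈ X.NSR :=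
    Submodule.subset_span w.2.1.2
  simp only [pairing_eq, MukaiVector.extend_sub, map_sub, LinearMap.sub_apply] at *
  rw [X.mukaiForm_comm (MukaiVector.extend ℝ v₁) (MukaiVector.extend ℝ v)] at *
  constructor
  · rintro ⟨⟨β, H, t⟩, ⟨-, hspan⟩, hH, -, ht⟩
    dsimp only at hspan hH ht
    simp only [centralCharge_eq_charge] at hspan
    have hmem := Submodule.mem_span_singleton_self (R := ℝ)
      (X.charge β (t • H : X.NSR) (MukaiVector.extend ℝ v₁))
    rw [hspan] at hmem
    obtain ⟨c, hc⟩ := Submodule.mem_span_singleton.1 hmem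
    have hv : v ≠ 0 := by
      rintro rfl
      have h0 : MukaiVector.extend ℝ (0 : X.MukaiVector) = 0 := by simp [MukaiVector.extend_real]
      rw [h0, map_zero, LinearMap.zero_apply] at h_pos
      linarith
    have hω : 0 < intersectionForm X.lattice (t • H : X.NSR) (t • H : X.NSR) := by
      have := hH.1
      rw [intersection_eq] at this
      simp only [Submodule.coe_smul, map_smul, LinearMap.smul_apply, smul_eq_mul]
      positivity
    have hle := X.NSR_le_hermitianForms
    have hneg := X.mukaiForm_self_neg_of_charge_eq_zero (hle β.2) (hle (t • H : X.NSR).2) hω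
      (u := MukaiVector.extend ℝ v₁ - c • MukaiVector.extend ℝ v)
      (hle (sub_mem (hNS v₁) (Submodule.smul_mem _ c (hNS v))))
      (by rw [map_sub, map_smul, hc, sub_self])
      (fun h0 => by
        obtain ⟨m, n, hn, hmn⟩ := exists_int_smul_eq_of_extend_eq_smul hv (sub_eq_zero.1 h0)
        exact h_indep m n hn hmn)
    simp only [map_sub, map_smul, LinearMap.sub_apply, LinearMap.smul_apply, smul_eq_mul] at hneg
    rw [X.mukaiForm_comm (MukaiVector.extend ℝ v₁) (MukaiVector.extend ℝ v)] at hneg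
    set A := X.mukaiForm (MukaiVector.extend ℝ v₁) (MukaiVector.extend ℝ v₁)
    set B := X.mukaiForm (MukaiVector.extend ℝ v) (MukaiVector.extend ℝ v₁)
    set C := X.mukaiForm (MukaiVector.extend ℝ v) (MukaiVector.extend ℝ v)
    by_contra! hdisc
    have hB : 0 < B := by linarith
    have hA : 0 < A := by
      refine lt_of_le_of_ne h_sq fun h0 => ?_
      rw [← h0] at hdisc
      nlinarith
    -- Completing the square: `A ⟨(v₁ - c v)²⟩ = (A - c B)² + c² (A C - B²)`.
    have h₁ := mul_neg_of_pos_of_neg hA hneg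
    have h₂ := mul_nonneg (sq_nonneg c) (sub_nonneg.2 hdisc)
    nlinarith [sq_nonneg (A - c * B)]
  · intro hdisc
    obtain ⟨x, y, hx, hy, hneg⟩ : ∃ x y : ℝ, 0 < x ∧ 0 < y ∧
        X.mukaiForm (x • MukaiVector.extend ℝ v₁
            - y • (MukaiVector.extend ℝ v - MukaiVector.extend ℝ v₁))
          (x • MukaiVector.extend ℝ v₁
            - y • (MukaiVector.extend ℝ v - MukaiVector.extend ℝ v₁)) < 0 := by
      simp only [map_sub, map_smul, LinearMap.sub_apply, LinearMap.smul_apply, smul_eq_mul]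
      rw [X.mukaiForm_comm (MukaiVector.extend ℝ v₁) (MukaiVector.extend ℝ v)]
      set A := X.mukaiForm (MukaiVector.extend ℝ v₁) (MukaiVector.extend ℝ v₁)
      set B := X.mukaiForm (MukaiVector.extend ℝ v) (MukaiVector.extend ℝ v₁)
      set C := X.mukaiForm (MukaiVector.extend ℝ v) (MukaiVector.extend ℝ v)
      set D := C - B - (B - A) with hD
      -- The discriminant is unchanged in the basis `v₁, v - v₁`.
      have hdisc' : A * D < (B - A) ^ 2 := by rw [hD]; linarith
      rcases h_sq.eq_or_lt with hA | hA
      · refine ⟨D + 1, B - A, by linarith, h_pos, ?_⟩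
        have := mul_pos (pow_pos h_pos 2) (by linarith : 0 < D + 2)
        linear_combination this - (D + 1) ^ 2 * hA
      · refine ⟨B - A, A, h_pos, hA, ?_⟩
        have := mul_pos hA (sub_pos.2 hdisc')
        linear_combination this
    obtain ⟨β, ω, hω, hZ⟩ := X.exists_charge_eq_zero_of_mukaiForm_self_neg
      (sub_mem (Submodule.smul_mem _ x (hNS v₁))
        (Submodule.smul_mem _ y (sub_mem (hNS v) (hNS v₁)))) hneg
    obtain ⟨H, t, rfl, hq⟩ := X.exists_mem_parameterSpace p β hω
    refine ⟨(β, H, t), ⟨X.parameterSpace_subset_bar p hq, ?_⟩, hq⟩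
    simp only [centralCharge_eq_charge]
    simp only [map_sub, map_smul] at hZ
    set z := X.charge β (t • H : X.NSR) (MukaiVector.extend ℝ v)
    set z₁ := X.charge β (t • H : X.NSR) (MukaiVector.extend ℝ v₁)
    have hz : z = ((x + y) / y) • z₁ := by
      have hyz : y • z = (x + y) • z₁ := by
        rw [add_smul, ← sub_eq_zero, ← neg_eq_zero, ← hZ, smul_sub]
        abel
      rw [div_eq_inv_mul, mul_smul, ← hyz, inv_smul_smul₀ hy.ne']
    rw [hz]
    exact (Submodule.span_singleton_smul_eq (IsUnit.mk0 _ (by positivity)) z₁).symm
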